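/- Let $(R,\mathfrak m,k)$ be a commutative complete Noetherian local ring, let $E$ be an injective hull of $k$, and write $M^\vee=\operatorname{Hom}_R(M,E)$. Let $\mathcal A$ be the class of Artinian $R$-modules; it contains $E$. A *preradical* $\alpha$ on $\mathcal A$ assigns to each $M\in\mathcal A$ a submodule $\alpha(M)\subseteq M$ such that $g(\alpha(M))\subseteq\alpha(N)$ for every $R$-linear map $g:M\to N$ in $\mathcal A$. Its *finitistic version* is $\alpha_f(M)=\sum\{\alpha(L)\mid L\subseteq M \text{ finitely generated},\ L\in\mathcal A\}$. For $\beta\in\{\alpha,\alpha_f\}$ let $\beta^{\smallsmile}(R)=(R^\vee/\beta(R^\vee))^\vee$, regarded as an ideal of $R$ by means of the inclusion $(R^\vee/\beta(R^\vee))^\vee\subseteq R^{\vee\vee}$ and the evaluation map $R\to R^{\vee\vee}$. Let $\lambda$ denote length. Then for every preradical $\alpha$ on $\mathcal A$: \begin{align*} \alpha^{\smallsmile}(R)&=\operatorname{ann}(\alpha(E))=\bigcap_{M\in\mathcal A}\operatorname{ann}(\alpha(M))\\ &\subseteq \alpha_f^{\smallsmile}(R)=\operatorname{ann}(\alpha_f(E))=\bigcap_{\lambda(M)<\infty}\operatorname{ann}(\alpha(M))\\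 &\subseteq\bigcap_{I\text{ ideal},\ \lambda(R/I)<\infty}\operatorname{ann}(\alpha(R/I)). \end{align*} Moreover, the last containment is an equality whenever $R$ is approximately Gorenstein, i.e. every power of $\mathfrak m$ contains an irreducible $\mathfrak m$-primary ideal; this is so, for example, if $R$ is reduced or if $R$ has depth at least $2$. Finally, let $\mathrm{cl}$ be a residual closure operation on Artinian modules and on all ideals: to each submodule $L\subseteq M$, where $M$ is Artinian or $M\cong R$, it assigns a submodule $L^{\mathrm{cl}}_M$ with $L\subseteq L^{\mathrm{cl}}_M\subseteq M$, compatibly with isomorphisms, such that $L^{\mathrm{cl}}_M\subseteq N^{\mathrm{cl}}_M$ for $L\subseteq N\subseteq M$, $(L^{\mathrm{cl}}_M)^{\mathrm{cl}}_M=L^{\mathrm{cl}}_M$, and $(\ker q)^{\mathrm{cl}}_M=q^{-1}(0^{\mathrm{cl}}_P)$ for every surjection $q:M\to P$ of such modules. Write $J^{\mathrm{cl}}=J^{\mathrm{cl}}_R$ for ideals $J$. Suppose that $\alpha$ represents $\mathrm{cl}$, i.e. $\alpha(M)=0^{\mathrm{cl}}_M$ for all $M\in\mathcal A$, and that for every ideal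 $J$ of $R$ there is a collection $\{I_\lambda\}_{\lambda\in\Lambda}$ of $\mathfrak m$-primary ideals with $J=\bigcap_\lambda I_\lambda$ and $J^{\mathrm{cl}}=\bigcap_\lambda I_\lambda^{\mathrm{cl}}$ (an empty intersection being $R$). Then \[\bigcap_{\lambda(R/I)<\infty}\operatorname{ann}(\alpha(R/I))=\bigcap_{I\text{ ideal of }R}(I:I^{\mathrm{cl}}).\] -/

import Mathlib

universe u

namespace TestIdeal

section Selectors

variable (R : Type u) [CommRing R]

/-- A class of `R`-modules. -/
abbrev ModuleClass : Type (u + 1) :=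
  ∀ (M : Type u) [AddCommGroup M] [Module R M], Prop

/-- The class of Artinian `R`-modules. -/
def artinianModules : ModuleClass R := fun M _ _ => IsArtinian R M

/-- The class consisting of the Artinian `R`-modules and of `R` itself (up to isomorphism).
An operation on it acts on submodules of Artinian modules and on all ideals of `R`. -/
def artinianModulesAndRing : ModuleClass R :=
  fun M _ _ => IsArtinian R M ∨ Nonempty (M ≃ₗ[R] R)

/-- A choice of a submodule of each module. A selection "on a class `𝓜`" is represented by such a
function of which only the values on members of `𝓜` matter; all laws below are required only on
members of `𝓜`. -/
abbrev Selection : Type (u + 1) :=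
  ∀ (M : Type u) [AddCommGroup M] [Module R M], Submodule R M

/-- An assignment `(L, M) ↦ e M L` of a submodule of `M` to each submodule `L` of `M`. Again only
the values on modules `M` of the class under consideration matter. -/
abbrev PairOperation : Type (u + 1) :=
  ∀ (M : Type u) [AddCommGroup M] [Module R M], Submodule R M → Submodule R M

variable {R}

/-- `α` is a submodule selector on `𝓜`: it commutes with isomorphisms between members of `𝓜`. -/
structure IsSubmoduleSelector (𝓜 : ModuleClass R) (α : Selection R) : Prop where
  map_equiv : ∀ (M N : Type u) [AddCommGroup M] [Module R M] [AddCommGroup N] [Module R N],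
    𝓜 M → 𝓜 N → ∀ φ : M ≃ₗ[R] N, (α M).map (φ : M →ₗ[R] N) = α N

/-- `α` is a preradical on `𝓜`: a functorial submodule selector. -/
structure IsPreradical (𝓜 : ModuleClass R) (α : Selection R) : Prop
    extends IsSubmoduleSelector 𝓜 α where
  map_le : ∀ (M N : Type u) [AddCommGroup M] [Module R M] [AddCommGroup N] [Module R N],
    𝓜 M → 𝓜 N → ∀ g : M →ₗ[R] N, (α M).map g ≤ α N

/-- The finitistic version `α_f` of a selection `α` on `𝓜`: `α_f(M)` is the sum of the `α(L)`,
where `L` ranges over the finitely generated submodules of `M` that belong to `𝓜`. -/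
def finitistic (𝓜 : ModuleClass R) (α : Selection R) : Selection R :=
  fun M _ _ => ⨆ (L : Submodule R M) (_ : L.FG) (_ : 𝓜 L), (α L).map L.subtype

/-- The dual `α^⌣` of a selection `α` with respect to `(-)^∨ = Hom_R(-, E)`:
`α^⌣(M) = (M^∨ / α(M^∨))^∨`, as a submodule of `M`. The dual of the projection
`M^∨ → M^∨ / α(M^∨)` identifies `(M^∨ / α(M^∨))^∨` with a submodule of `M^∨∨`, which is pulled back
along the evaluation map `M → M^∨∨`. -/
def smileDual (E : Type u) [AddCommGroup E] [Module R E] (α : Selection R) : Selection R :=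
  fun M _ _ =>
    (LinearMap.range (LinearMap.lcomp R E (α (M →ₗ[R] E)).mkQ)).comap
      (LinearMap.applyₗ : M →ₗ[R] (M →ₗ[R] E) →ₗ[R] E)

/-- `e` is an extensive operation on the pairs `L ⊆ M` with `M` in `𝓜`. -/
structure IsExtensiveOperation (𝓜 : ModuleClass R) (e : PairOperation R) : Prop where
  le_self : ∀ (M : Type u) [AddCommGroup M] [Module R M], 𝓜 M →
    ∀ L : Submodule R M, L ≤ e M L
  map_equiv : ∀ (M N : Type u) [AddCommGroup M] [Module R M] [AddCommGroup N] [Module R N],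
    𝓜 M → 𝓜 N → ∀ (φ : M ≃ₗ[R] N) (L : Submodule R M),
      (e M L).map (φ : M →ₗ[R] N) = e N (L.map (φ : M →ₗ[R] N))

/-- `e` is a residual closure operation on the pairs `L ⊆ M` with `M` in `𝓜`: an extensive
operation that is order-preserving on submodules, idempotent and residual. -/
structure IsResidualClosure (𝓜 : ModuleClass R) (e : PairOperation R) : Prop
    extends IsExtensiveOperation 𝓜 e where
  mono : ∀ (N : Type u) [AddCommGroup N] [Module R N], 𝓜 N →
    ∀ L M : Submodule R N, L ≤ M → e N L ≤ e N M
  idem : ∀ (M : Type u) [AddCommGroup M] [Module R M], 𝓜 M →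
    ∀ L : Submodule R M, e M (e M L) = e M L
  residual : ∀ (M P : Type u) [AddCommGroup M] [Module R M] [AddCommGroup P] [Module R P],
    𝓜 M → 𝓜 P → ∀ q : M →ₗ[R] P, Function.Surjective q →
      e M (LinearMap.ker q) = (e P ⊥).comap q

/-- `α` represents the operation `e` on `𝓜`: `α(M) = 0^e_M` for all `M` in `𝓜`. -/
def Represents (𝓜 : ModuleClass R) (α : Selection R) (e : PairOperation R) : Prop :=
  ∀ (M : Type u) [AddCommGroup M] [Module R M], 𝓜 M → α M = e M ⊥

end Selectors

section Local

variable (R : Type u) [CommRing R] [IsLocalRing R]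

/-- `E`, together with `ι : k → E`, is an injective hull of the residue field `k` of `R`: `E` is an
injective `R`-module and `ι` is an essential monomorphism. -/
structure IsInjectiveHull (E : Type u) [AddCommGroup E] [Module R E]
    (ι : IsLocalRing.ResidueField R →ₗ[R] E) : Prop where
  injective_module : Module.Injective R E
  injective_map : Function.Injective ι
  essential : ∀ N : Submodule R E, N ⊓ LinearMap.range ι = ⊥ → N = ⊥

variable {R}

/-- `I` is primary to the maximal ideal of `R`. -/
def IsMPrimary (I : Ideal R) : Prop :=
  I.IsPrimary ∧ I.radical = IsLocalRing.maximalIdeal R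

variable (R)

/-- `R` is approximately Gorenstein: every power of the maximal ideal `𝔪` contains an irreducible
`𝔪`-primary ideal. -/
def IsApproximatelyGorenstein : Prop :=
  ∀ n : ℕ, ∃ I : Ideal R, I ≤ IsLocalRing.maximalIdeal R ^ n ∧ IsMPrimary I ∧ InfIrred I

/-- `R` has depth at least two: there is an `R`-regular sequence of length two in the maximal
ideal. -/
def DepthAtLeastTwo : Prop :=
  ∃ x ∈ IsLocalRing.maximalIdeal R, ∃ y ∈ IsLocalRing.maximalIdeal R,
    RingTheory.Sequence.IsRegular R [x, y]

/-- For every ideal `J` there is a collection of `𝔪`-primary ideals with intersection `J` whose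
closures have intersection the closure of `J`. -/
def HasMPrimaryApproximation (cl : PairOperation R) : Prop :=
  ∀ J : Ideal R, ∃ S : Set (Ideal R),
    (∀ I ∈ S, IsMPrimary I) ∧ J = (⨅ I ∈ S, I) ∧ cl R J = (⨅ I ∈ S, cl R I)

end Local

end TestIdeal

namespace TestIdeal

open IsLocalRing Submodule

/-! ### Quotients of finite length and `𝔪`-primary ideals. -/

section FiniteLength

variable {R : Type u} [CommRing R] [IsLocalRing R]

/-! The engine is Matlis duality, built from the injective hull alone. Every nonzero element of a
module survives under some map to `E`, so `r` kills `α M` once `r • f x = 0` for all `x ∈ α M` and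
`f : M → E`. Functoriality puts `f x` in `α E`, and even in `α_f E` when `M` has finite length, as
the image of `f` is then finitely generated. Conversely `E` is itself Artinian, and `α_f E` is a sum
of images of `α L` with `L` of finite length. With `Hom(R, E) ≅ E` this settles everything but the
comparison with cyclic modules.

If `I` is irreducible and `𝔪`-primary, then `R ⧸ I` is isomorphic to `0 :_E I`. The image in `E` of
a module of finite length is killed by some `𝔪 ^ n`, so the map factors through `R ⧸ I` for any such
`I ≤ 𝔪 ^ n`, and cyclic modules suffice.

For the examples, it is enough that any two elements of `E` are multiples of a third: then `0 :_E 𝔪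
^ (n + 1)` lies in some `R ∙ e`, whose annihilator is irreducible and inside `𝔪 ^ (n + 1)`. A
regular sequence of length two produces such common divisors directly. If `R` is reduced, the double
annihilator property writes `E` as the sum of the `0 :_E P` over the minimal primes `P`; each is
locally cyclic, and the pieces are glued.

For closures, residuality turns `ann α(R ⧸ I)` into `I : I^cl`, and intersections of `𝔪`-primary
ideals reach every ideal. -/

theorem isMPrimary_of_maximalIdeal_pow_le {I : Ideal R} {n : ℕ} (h : maximalIdeal R ^ n ≤ I)
    (hI : I ≠ ⊤) : IsMPrimary I := by
  have hr : I.radical = maximalIdeal R :=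
    le_antisymm (le_maximalIdeal (by rwa [Ne, Ideal.radical_eq_top]))
      fun x hx => ⟨n, h (Ideal.pow_mem_pow hx n)⟩
  exact ⟨Ideal.isPrimary_of_isMaximal_radical (by rw [hr]; infer_instance), hr⟩

variable [IsNoetherianRing R]

theorem isFiniteLength_quotient_of_maximalIdeal_pow_le {I : Ideal R} {n : ℕ}
    (h : maximalIdeal R ^ n ≤ I) : IsFiniteLength R (R ⧸ I) := by
  by_cases hI : I = ⊤
  · have : Subsingleton (R ⧸ I) := Ideal.Quotient.subsingleton_iff.mpr hI
    exact .of_subsingleton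
  have hm : maximalIdeal R ∈ I.minimalPrimes := by
    refine ⟨⟨inferInstance, le_maximalIdeal hI⟩, fun Q hQ _ => ?_⟩
    have := hQ.1
    exact Ideal.IsPrime.le_of_pow_le (h.trans hQ.2)
  have := quotient_artinian_of_mem_minimalPrimes_of_isLocalRing I hm
  have hl := (isArtinianRing_iff_isFiniteLength (R ⧸ I)).mp this
  rw [← Module.length_ne_top_iff] at hl ⊢
  rwa [Module.length_eq_of_surjective (S := R) (R := R ⧸ I) (M := R ⧸ I)
    Ideal.Quotient.mk_surjective]

theorem IsMPrimary.exists_maximalIdeal_pow_le {I : Ideal R} (h : IsMPrimary I) :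
    ∃ n, maximalIdeal R ^ n ≤ I := by
  rw [← h.2]
  exact I.exists_radical_pow_le_of_fg (IsNoetherian.noetherian _)

theorem IsMPrimary.isFiniteLength {I : Ideal R} (h : IsMPrimary I) :
    IsFiniteLength R (R ⧸ I) :=
  isFiniteLength_quotient_of_maximalIdeal_pow_le h.exists_maximalIdeal_pow_le.choose_spec

end FiniteLength

/-! ### Matlis duality in finite length. -/

namespace IsInjectiveHull

variable {R : Type u} [CommRing R] [IsLocalRing R]
  {E : Type u} [AddCommGroup E] [Module R E] {ι : ResidueField R →ₗ[R] E}

theorem map_one_ne_zero (hE : IsInjectiveHull R E ι) : ι 1 ≠ 0 := fun h =>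
  one_ne_zero (hE.injective_map (h.trans (map_zero ι).symm))

theorem smul_map_one_eq_zero_iff (hE : IsInjectiveHull R E ι) {r : R} :
    r • ι 1 = 0 ↔ r ∈ maximalIdeal R := by
  rw [← map_smul, map_eq_zero_iff ι hE.injective_map, Algebra.smul_def, mul_one]
  exact residue_eq_zero_iff r

theorem mem_range_iff {e : E} : e ∈ LinearMap.range ι ↔ ∃ r : R, r • ι 1 = e := by
  constructor
  · rintro ⟨z, rfl⟩
    obtain ⟨r, rfl⟩ := residue_surjective z
    refine ⟨r, ?_⟩
    rw [← map_smul, Algebra.smul_def, mul_one]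
    rfl
  · rintro ⟨r, rfl⟩
    exact ⟨r • 1, map_smul _ _ _⟩

theorem map_one_mem (hE : IsInjectiveHull R E ι) {N : Submodule R E} (hN : N ≠ ⊥) : ι 1 ∈ N := by
  obtain ⟨e, he, h0⟩ := (Submodule.ne_bot_iff _).mp (mt (hE.essential N) hN)
  obtain ⟨r, rfl⟩ := mem_range_iff.mp he.2
  have hr : IsUnit r := by
    by_contra hr
    exact h0 (hE.smul_map_one_eq_zero_iff.mpr ((mem_maximalIdeal r).mpr hr))
  exact (N.smul_mem_iff_of_isUnit hr).mp he.1

/-- A partial map defined on a cyclic submodule extends. -/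
theorem exists_hom_apply_eq (hE : IsInjectiveHull R E ι) {M : Type u} [AddCommGroup M] [Module R M]
    (x : M) (e : E) (h : ∀ r : R, r • x = 0 → r • e = 0) : ∃ f : M →ₗ[R] E, f x = e := by
  have := hE.injective_module
  let K := LinearMap.ker (LinearMap.toSpanSingleton R M x)
  have hK : K ≤ LinearMap.ker (LinearMap.toSpanSingleton R E e) := fun r hr => h r hr
  obtain ⟨f, hf⟩ := Module.Injective.out (K.liftQ (LinearMap.toSpanSingleton R M x) le_rfl)
    (LinearMap.ker_eq_bot.mp (Submodule.ker_liftQ_eq_bot _ _ _ le_rfl))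
    (K.liftQ (LinearMap.toSpanSingleton R E e) hK)
  refine ⟨f, ?_⟩
  have := hf (K.mkQ 1)
  rwa [Submodule.mkQ_apply, Submodule.liftQ_apply, Submodule.liftQ_apply,
    LinearMap.toSpanSingleton_apply, LinearMap.toSpanSingleton_apply, one_smul, one_smul] at this

theorem exists_hom_apply_ne_zero (hE : IsInjectiveHull R E ι) {M : Type u} [AddCommGroup M]
    [Module R M] {x : M} (hx : x ≠ 0) : ∃ f : M →ₗ[R] E, f x ≠ 0 := by
  obtain ⟨f, hf⟩ := hE.exists_hom_apply_eq x (ι 1) fun r hr => by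
    rw [hE.smul_map_one_eq_zero_iff, mem_maximalIdeal]
    exact fun hu => hx (hu.smul_eq_zero.mp hr)
  exact ⟨f, hf ▸ hE.map_one_ne_zero⟩

/-- Extend the map that sends the class of `a` in `R ⧸ J` to `e`, and evaluate at `1`: inside `0 :_E
J`, divisibility by `a` is obstructed only by `J : a`. -/
theorem exists_smul_eq (hE : IsInjectiveHull R E ι) (J : Ideal R) (a : R) (e : E)
    (h : ∀ r, r * a ∈ J → r • e = 0) : ∃ e' : E, (∀ r ∈ J, r • e' = 0) ∧ a • e' = e := by
  obtain ⟨f, hf⟩ := hE.exists_hom_apply_eq (Ideal.Quotient.mk J a) e fun r hr => h r <| by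
    rwa [← Ideal.Quotient.eq_zero_iff_mem, map_mul]
  refine ⟨f 1, fun r hr => ?_, ?_⟩
  · rw [← map_smul, Algebra.smul_def, mul_one, Ideal.Quotient.algebraMap_eq,
      Ideal.Quotient.eq_zero_iff_mem.mpr hr, map_zero]
  · rw [← map_smul, Algebra.smul_def, mul_one, Ideal.Quotient.algebraMap_eq, hf]

theorem mem_of_smul_eq_zero (hE : IsInjectiveHull R E ι) {I : Ideal R} {r : R}
    (h : ∀ e : E, (∀ a ∈ I, a • e = 0) → r • e = 0) : r ∈ I := by
  by_contra hr
  rw [← Ideal.Quotient.eq_zero_iff_mem] at hr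
  obtain ⟨f, hf⟩ := hE.exists_hom_apply_ne_zero hr
  have key : ∀ a : R, a • f 1 = f (Ideal.Quotient.mk I a) := fun a => by
    rw [← map_smul, Algebra.smul_def, mul_one, Ideal.Quotient.algebraMap_eq]
  refine hf ?_
  rw [← key]
  refine h _ fun a ha => ?_
  rw [key, Ideal.Quotient.eq_zero_iff_mem.mpr ha, map_zero]

theorem annihilator_torsionBySet (hE : IsInjectiveHull R E ι) (I : Ideal R) :
    (torsionBySet R E (I : Set R)).annihilator = I := by
  refine le_antisymm (fun r hr => hE.mem_of_smul_eq_zero fun e he => ?_) fun r hr => ?_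
  · exact Submodule.mem_annihilator.mp hr e ((mem_torsionBySet_iff _ _).mpr fun a => he a a.2)
  · exact Submodule.mem_annihilator.mpr fun e he => (mem_torsionBySet_iff _ _).mp he ⟨r, hr⟩

theorem mem_range_of_maximalIdeal_smul (hE : IsInjectiveHull R E ι) {e : E}
    (h : ∀ r ∈ maximalIdeal R, r • e = 0) : e ∈ LinearMap.range ι := by
  by_cases he : e = 0
  · rw [he]; exact zero_mem _
  have h1 := hE.map_one_mem (N := R ∙ e) (by simpa using he)
  obtain ⟨r, hr⟩ := mem_span_singleton.mp h1
  have hu : IsUnit r := by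
    by_contra hu
    exact hE.map_one_ne_zero (hr ▸ h r ((mem_maximalIdeal r).mpr hu))
  obtain ⟨u, rfl⟩ := hu
  exact mem_range_iff.mpr ⟨(u⁻¹ : Rˣ), by rw [← hr, smul_smul, Units.inv_mul, one_smul]⟩

/-- A map out of `S` is determined by its value at a generator, and that value is killed by `𝔪`,
hence lies in the socle `ι(k)`, which any of its nonzero elements generates. -/
theorem isSimpleModule_dual (hE : IsInjectiveHull R E ι) {S : Type u} [AddCommGroup S] [Module R S]
    [IsSimpleModule R S] : IsSimpleModule R (S →ₗ[R] E) := by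
  have hnt := IsSimpleModule.nontrivial R S
  obtain ⟨s, hs⟩ := exists_ne (0 : S)
  have hgen := (isSimpleModule_iff_toSpanSingleton_surjective.mp
    (inferInstance : IsSimpleModule R S)).2 s hs
  have hm : ∀ f : S →ₗ[R] E, f s ∈ LinearMap.range ι := fun f =>
    hE.mem_range_of_maximalIdeal_smul fun r hr => by
      have hann : Module.annihilator R S = maximalIdeal R :=
        eq_maximalIdeal IsSimpleModule.annihilator_isMaximal
      rw [← hann, Module.mem_annihilator] at hr
      rw [← map_smul, hr, map_zero]
  rw [isSimpleModule_iff_toSpanSingleton_surjective]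
  constructor
  · obtain ⟨f, hf⟩ := hE.exists_hom_apply_ne_zero hs
    exact ⟨f, 0, fun h => hf (by rw [h, LinearMap.zero_apply])⟩
  · intro f hf g
    have hfs : f s ≠ 0 := fun h => hf <| LinearMap.ext fun t => by
      obtain ⟨r, rfl⟩ := hgen t
      simp [h]
    have h1 := hE.map_one_mem (N := R ∙ f s) (by simpa using hfs)
    obtain ⟨a, ha⟩ := mem_span_singleton.mp h1
    obtain ⟨b, hb⟩ := mem_range_iff.mp (hm g)
    refine ⟨b * a, LinearMap.ext fun t => ?_⟩
    obtain ⟨r, rfl⟩ := hgen t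
    simp [← hb, ← ha, mul_smul]

/-- The functor `Hom(-, E)` preserves length. -/
theorem length_dual (hE : IsInjectiveHull R E ι) {M : Type u} [AddCommGroup M] [Module R M]
    (hM : IsFiniteLength R M) : Module.length R (M →ₗ[R] E) = Module.length R M := by
  induction hM with
  | @of_subsingleton M _ _ _ =>
    have : Subsingleton (M →ₗ[R] E) := ⟨fun f g => LinearMap.ext fun x => by
      rw [Subsingleton.elim x 0, map_zero, map_zero]⟩
    rw [Module.length_eq_zero, Module.length_eq_zero]
  | @of_simple_quotient M _ _ N hS _ ih =>
    have := hE.injective_module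
    have hsimple := Module.length_eq_one_iff.mpr (hE.isSimpleModule_dual (S := M ⧸ N))
    rw [Module.length_eq_add_of_exact (LinearMap.lcomp R E N.mkQ) (LinearMap.lcomp R E N.subtype)
      ?_ ?_ ?_, hsimple, ih, Module.length_eq_add_of_exact N.subtype N.mkQ N.injective_subtype
        N.mkQ_surjective (LinearMap.exact_subtype_mkQ N), Module.length_eq_one R (M ⧸ N), add_comm]
    · intro f g hfg
      exact LinearMap.cancel_right N.mkQ_surjective |>.mp hfg
    · intro f
      obtain ⟨g, hg⟩ := Module.Injective.out N.subtype N.injective_subtype f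
      exact ⟨g, LinearMap.ext hg⟩
    · intro f
      constructor
      · intro hf
        exact ⟨N.liftQ f fun x hx => LinearMap.congr_fun hf ⟨x, hx⟩, by ext; rfl⟩
      · rintro ⟨g, rfl⟩
        ext x
        change g (N.mkQ x) = 0
        rw [Submodule.mkQ_apply, (Submodule.Quotient.mk_eq_zero N).mpr x.2, map_zero]
/-- `Hom(R / I, E)` is the submodule of `E` annihilated by `I`. -/
noncomputable def homQuotientEquiv (E : Type u) [AddCommGroup E] [Module R E] (I : Ideal R) :
    ((R ⧸ I) →ₗ[R] E) ≃ₗ[R] torsionBySet R E (I : Set R) :=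
  LinearEquiv.ofBijective
    (LinearMap.codRestrict _ (LinearMap.applyₗ (1 : R ⧸ I)) fun f => by
      rw [mem_torsionBySet_iff]
      rintro ⟨a, ha⟩
      rw [LinearMap.applyₗ_apply_apply, ← map_smul, Algebra.smul_def, mul_one,
        Ideal.Quotient.algebraMap_eq, Ideal.Quotient.eq_zero_iff_mem.mpr ha, map_zero])
    (by
      constructor
      · intro f g h
        refine LinearMap.ext fun x => ?_
        obtain ⟨r, rfl⟩ := Ideal.Quotient.mk_surjective x
        have h1 : f 1 = g 1 := congrArg Subtype.val h
        have h2 : Ideal.Quotient.mk I r = r • (1 : R ⧸ I) := by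
          rw [Algebra.smul_def, mul_one, Ideal.Quotient.algebraMap_eq]
        rw [h2, map_smul, map_smul, h1]
      · rintro ⟨e, he⟩
        rw [mem_torsionBySet_iff] at he
        refine ⟨I.liftQ (LinearMap.toSpanSingleton R E e) fun a ha => he ⟨a, ha⟩, ?_⟩
        exact Subtype.ext (one_smul R e))

theorem length_torsionBySet (hE : IsInjectiveHull R E ι) {I : Ideal R}
    (hI : IsFiniteLength R (R ⧸ I)) :
    Module.length R (torsionBySet R E (I : Set R)) = Module.length R (R ⧸ I) := by
  rw [← (homQuotientEquiv E I).length_eq, hE.length_dual hI]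

theorem isFiniteLength_torsionBySet (hE : IsInjectiveHull R E ι) {I : Ideal R}
    (hI : IsFiniteLength R (R ⧸ I)) : IsFiniteLength R (torsionBySet R E (I : Set R)) := by
  rw [← Module.length_ne_top_iff, hE.length_torsionBySet hI]
  exact Module.length_ne_top_iff.mpr hI

/-- Every map from the submodule annihilated by a cofinite ideal is a homothety. -/
theorem exists_hom_torsionBySet_eq_smul (hE : IsInjectiveHull R E ι) {I : Ideal R}
    (hI : IsFiniteLength R (R ⧸ I)) (f : torsionBySet R E (I : Set R) →ₗ[R] E) :
    ∃ r : R, ∀ e, f e = r • (e : E) := by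
  let Z := torsionBySet R E (I : Set R)
  have hZ : IsFiniteLength R Z := hE.isFiniteLength_torsionBySet hI
  have hl : Module.length R (Z →ₗ[R] E) = Module.length R (R ⧸ I) := by
    rw [hE.length_dual hZ, hE.length_torsionBySet hI]
  have hfin : IsFiniteLength R (Z →ₗ[R] E) := by
    rw [← Module.length_ne_top_iff] at hI ⊢
    rwa [hl]
  obtain ⟨_, _⟩ := isFiniteLength_iff_isNoetherian_isArtinian.mp hfin
  let φ : R →ₗ[R] (Z →ₗ[R] E) := LinearMap.toSpanSingleton R _ Z.subtype
  have hker : LinearMap.ker φ = I := by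
    refine le_antisymm (fun r hr => hE.mem_of_smul_eq_zero fun e he => ?_) fun r hr => ?_
    · exact LinearMap.congr_fun (LinearMap.mem_ker.mp hr)
        ⟨e, (mem_torsionBySet_iff _ _).mpr fun a => he a a.2⟩
    · refine LinearMap.mem_ker.mpr (LinearMap.ext fun e => ?_)
      exact (mem_torsionBySet_iff _ _).mp e.2 ⟨r, hr⟩
  -- Homotheties embed `R ⧸ I` in a module of the same finite length, so they fill it.
  have hrange : LinearMap.range φ = ⊤ := by
    by_contra h
    have := Submodule.length_lt h
    rw [hl, ← φ.quotKerEquivRange.length_eq, hker] at this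
    exact this.false
  obtain ⟨r, hr⟩ := LinearMap.range_eq_top.mp hrange f
  exact ⟨r, fun e => by rw [← hr]; rfl⟩

/-! ### Endomorphisms of `E` and the double annihilator property. -/

section Noetherian

variable [IsNoetherianRing R]

/-- Artin–Rees for the socle of `R ∙ e`: one power past the Artin–Rees constant, `𝔪 ^ (k + 1) • N`
meets the socle inside `𝔪 • socle = 0`. A nonzero submodule of `E` would contain `ι 1`. -/
theorem exists_maximalIdeal_pow_smul_eq_zero (hE : IsInjectiveHull R E ι) (e : E) :
    ∃ n, ∀ r ∈ maximalIdeal R ^ n, r • e = 0 := by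
  let N : Submodule R E := R ∙ e
  obtain ⟨k, hk⟩ := (maximalIdeal R).exists_pow_inf_eq_pow_smul
    ((LinearMap.range ι).comap N.subtype)
  refine ⟨k + 1, fun r hr => ?_⟩
  by_contra h0
  have h1 := hE.map_one_mem (N := (maximalIdeal R ^ (k + 1)) • N) <|
    (Submodule.ne_bot_iff _).mpr
      ⟨r • e, Submodule.smul_mem_smul hr (mem_span_singleton_self e), h0⟩
  have hmem : ι 1 ∈ ((maximalIdeal R ^ (k + 1)) • (⊤ : Submodule R N)).map N.subtype := by
    rwa [Submodule.map_smul'', Submodule.map_top, Submodule.range_subtype]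
  obtain ⟨z, hz, hz1⟩ := hmem
  have hz' := (hk (k + 1) (by omega)).le ⟨hz, show N.subtype z ∈ LinearMap.range ι from
    hz1 ▸ ⟨1, rfl⟩⟩
  have hz2 : z ∈ maximalIdeal R • ((LinearMap.range ι).comap N.subtype) := by
    rw [Nat.add_sub_cancel_left, pow_one] at hz'
    exact Submodule.smul_mono le_rfl inf_le_right hz'
  have hz3 : z = 0 := by
    refine Submodule.smul_induction_on hz2 (p := fun z => z = 0) ?_ ?_
    · intro a ha y hy
      obtain ⟨b, hb⟩ := mem_range_iff.mp (show N.subtype y ∈ LinearMap.range ι from hy)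
      apply N.injective_subtype
      rw [map_smul, ← hb, smul_comm, hE.smul_map_one_eq_zero_iff.mpr ha, smul_zero, map_zero]
    · rintro _ _ rfl rfl
      exact add_zero 0
  exact hE.map_one_ne_zero (by rw [← hz1, hz3, map_zero])

variable [IsAdicComplete (maximalIdeal R) R]

/-- Over a complete ring every endomorphism of `E` is a homothety. -/
theorem exists_end_eq_smul (hE : IsInjectiveHull R E ι) (f : E →ₗ[R] E) :
    ∃ r : R, ∀ e, f e = r • e := by
  have hfl : ∀ n, IsFiniteLength R (R ⧸ maximalIdeal R ^ n) := fun n =>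
    isFiniteLength_quotient_of_maximalIdeal_pow_le le_rfl
  choose a ha using fun n => hE.exists_hom_torsionBySet_eq_smul (hfl n)
    (f ∘ₗ (torsionBySet R E ((maximalIdeal R ^ n : Ideal R) : Set R)).subtype)
  have ha' : ∀ n e, (∀ r ∈ maximalIdeal R ^ n, r • e = 0) → f e = a n • e := fun n e he =>
    ha n ⟨e, (mem_torsionBySet_iff _ _).mpr fun r => he r r.2⟩
  -- The multipliers `a n` on the layers `0 :_E 𝔪 ^ n` form a Cauchy sequence, because `𝔪 ^ m` is
  -- the full annihilator of its layer. The layers exhaust `E`, so the limit works everywhere.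
  obtain ⟨r, hr⟩ := IsPrecomplete.prec (I := maximalIdeal R) (M := R) inferInstance (f := a) <| by
    intro m n hmn
    rw [SModEq.sub_mem, smul_eq_mul, Ideal.mul_top]
    refine hE.mem_of_smul_eq_zero fun e he => ?_
    rw [sub_smul, ← ha' m e he, ← ha' n e fun r hr => he r (Ideal.pow_le_pow_right hmn hr), sub_self]
  refine ⟨r, fun e => ?_⟩
  obtain ⟨n, hn⟩ := hE.exists_maximalIdeal_pow_smul_eq_zero e
  have := hr n
  rw [SModEq.sub_mem, smul_eq_mul, Ideal.mul_top] at this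
  rw [ha' n e hn, ← sub_eq_zero, ← sub_smul, hn _ this]

/-- A submodule of `E` consists of all elements annihilated by its annihilator. -/
theorem mem_of_annihilator_smul_eq_zero (hE : IsInjectiveHull R E ι) {N : Submodule R E} {e : E}
    (h : ∀ r ∈ N.annihilator, r • e = 0) : e ∈ N := by
  by_contra he
  obtain ⟨f, hf⟩ := hE.exists_hom_apply_ne_zero (x := N.mkQ e) (by simpa using he)
  -- The composite `E → E ⧸ N → E` is multiplication by an element that annihilates `N`.
  obtain ⟨r, hr⟩ := hE.exists_end_eq_smul (f ∘ₗ N.mkQ)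
  refine hf ?_
  rw [← LinearMap.comp_apply, hr]
  refine h r (Submodule.mem_annihilator.mpr fun z hz => ?_)
  rw [← hr, LinearMap.comp_apply, Submodule.mkQ_apply, (Submodule.Quotient.mk_eq_zero N).mpr hz,
    map_zero]

/-- By the double annihilator property, annihilators turn a descending chain in `E` into an
ascending chain of ideals without losing information. -/
theorem isArtinian (hE : IsInjectiveHull R E ι) : IsArtinian R E := by
  rw [← monotone_stabilizes_iff_artinian]
  intro f
  obtain ⟨n, hn⟩ := monotone_stabilizes_iff_noetherian.mpr (inferInstance : IsNoetherian R R)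
    ⟨fun k => (OrderDual.ofDual (f k)).annihilator, fun i j hij =>
      Submodule.annihilator_mono (f.monotone hij)⟩
  refine ⟨n, fun m hm => ?_⟩
  have h1 : (OrderDual.ofDual (f n)).annihilator = (OrderDual.ofDual (f m)).annihilator := hn m hm
  refine le_antisymm (f.monotone hm) fun e he => ?_
  exact hE.mem_of_annihilator_smul_eq_zero fun r hr => Submodule.mem_annihilator.mp (h1 ▸ hr) e he

end Noetherian


end IsInjectiveHull

/-! ### Preradicals, their finitistic versions and their duals. -/

section Preradical

variable {R : Type u} [CommRing R]

theorem artinianModules_of_isFiniteLength {M : Type u} [AddCommGroup M] [Module R M]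
    (h : IsFiniteLength R M) : artinianModules R M :=
  (isFiniteLength_iff_isNoetherian_isArtinian.mp h).2

theorem isFiniteLength_of_fg_of_isArtinian [IsNoetherianRing R] {M : Type u} [AddCommGroup M]
    [Module R M] {L : Submodule R M} (hL : L.FG) (h : artinianModules R L) :
    IsFiniteLength R L := by
  have : Module.Finite R L := Module.Finite.iff_fg.mpr hL
  exact isFiniteLength_iff_isNoetherian_isArtinian.mpr ⟨inferInstance, h⟩

theorem IsPreradical.apply_mem {𝓜 : ModuleClass R} {α : Selection R} (hα : IsPreradical 𝓜 α)
    {M N : Type u} [AddCommGroup M] [Module R M] [AddCommGroup N] [Module R N]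
    (hM : 𝓜 M) (hN : 𝓜 N) (g : M →ₗ[R] N) {x : M} (hx : x ∈ α M) : g x ∈ α N :=
  hα.map_le M N hM hN g (mem_map_of_mem hx)

theorem IsPreradical.isSubmoduleSelector_of_map_le {𝓜 : ModuleClass R} {α : Selection R}
    (h : ∀ (M N : Type u) [AddCommGroup M] [Module R M] [AddCommGroup N] [Module R N],
      𝓜 M → 𝓜 N → ∀ g : M →ₗ[R] N, (α M).map g ≤ α N) : IsSubmoduleSelector 𝓜 α where
  map_equiv M N _ _ _ _ hM hN φ := by
    refine le_antisymm (h M N hM hN φ) fun x hx => ?_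
    exact ⟨φ.symm x, h N M hN hM φ.symm (mem_map_of_mem hx), φ.apply_symm_apply x⟩

theorem mem_finitistic {α : Selection R} {M : Type u} [AddCommGroup M] [Module R M]
    {L : Submodule R M} (hL : L.FG) (hLA : artinianModules R L) {x : L} (hx : x ∈ α L) :
    (x : M) ∈ TestIdeal.finitistic (artinianModules R) α M :=
  mem_iSup_of_mem L (mem_iSup_of_mem hL (mem_iSup_of_mem hLA (mem_map_of_mem (f := L.subtype) hx)))

/-- The finitistic version of a preradical on Artinian modules is a preradical. -/
theorem IsPreradical.finitistic {α : Selection R} (hα : IsPreradical (artinianModules R) α) :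
    IsPreradical (artinianModules R) (finitistic (artinianModules R) α) := by
  have key : ∀ (M N : Type u) [AddCommGroup M] [Module R M] [AddCommGroup N] [Module R N],
      artinianModules R M → artinianModules R N → ∀ g : M →ₗ[R] N,
        (TestIdeal.finitistic (artinianModules R) α M).map g ≤
          TestIdeal.finitistic (artinianModules R) α N := by
    intro M N _ _ _ _ hM hN g
    have : IsArtinian R N := hN
    simp only [TestIdeal.finitistic, Submodule.map_iSup]
    refine iSup_le fun L => iSup_le fun hL => iSup_le fun hLA => ?_
    have hA : artinianModules R (L.map g) := inferInstanceAs (IsArtinian R (L.map g))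
    rintro _ ⟨_, ⟨x, hx, rfl⟩, rfl⟩
    let g' : L →ₗ[R] L.map g := g.restrict fun x hx => mem_map_of_mem hx
    exact mem_finitistic (hL.map g) hA (hα.apply_mem hLA hA g' hx)
  exact ⟨IsPreradical.isSubmoduleSelector_of_map_le key, key⟩

theorem IsPreradical.finitistic_le {α : Selection R} (hα : IsPreradical (artinianModules R) α)
    {M : Type u} [AddCommGroup M] [Module R M] (hM : artinianModules R M) :
    TestIdeal.finitistic (artinianModules R) α M ≤ α M :=
  iSup_le fun L => iSup_le fun _ => iSup_le fun hLA => hα.map_le L M hLA hM L.subtype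

theorem mem_smileDual_iff {E : Type u} [AddCommGroup E] [Module R E] {α : Selection R} {r : R} :
    r ∈ smileDual E α R ↔ ∀ f ∈ α (R →ₗ[R] E), f r = 0 := by
  constructor
  · rintro ⟨g, hg⟩ f hf
    have h1 : g ((α (R →ₗ[R] E)).mkQ f) = f r := LinearMap.congr_fun hg f
    rw [← h1, Submodule.mkQ_apply, (Submodule.Quotient.mk_eq_zero _).mpr hf, map_zero]
  · intro h
    exact ⟨(α (R →ₗ[R] E)).liftQ (LinearMap.applyₗ r) h, by ext; rfl⟩

/-- The dual of a selector at `R` is the annihilator of its value at `E`. -/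
theorem IsSubmoduleSelector.smileDual_eq {E : Type u} [AddCommGroup E] [Module R E]
    [hE : IsArtinian R E] {α : Selection R} (hα : IsSubmoduleSelector (artinianModules R) α) :
    smileDual E α R = (α E).annihilator := by
  let φ : (R →ₗ[R] E) ≃ₗ[R] E := LinearMap.ringLmapEquivSelf R R E
  have hφ := hα.map_equiv (R →ₗ[R] E) E (φ.isArtinian_iff.mpr hE) hE φ
  have happ : ∀ (f : R →ₗ[R] E) (r : R), r • φ f = f r := fun f r => by
    rw [LinearMap.ringLmapEquivSelf_apply, ← map_smul, smul_eq_mul, mul_one]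
  ext r
  rw [mem_smileDual_iff, Submodule.mem_annihilator, ← hφ]
  constructor
  · rintro h _ ⟨f, hf, rfl⟩
    exact (happ f r).trans (h f hf)
  · intro h f hf
    rw [← happ]
    exact h _ (mem_map_of_mem hf)

theorem mem_annihilator_finitistic [IsNoetherianRing R] {α : Selection R} {r : R} {M : Type u}
    [AddCommGroup M] [Module R M]
    (h : ∀ (L : Type u) [AddCommGroup L] [Module R L], IsFiniteLength R L →
      r ∈ (α L).annihilator) :
    r ∈ (finitistic (artinianModules R) α M).annihilator := by
  rw [Submodule.mem_annihilator]
  intro x hx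
  suffices finitistic (artinianModules R) α M ≤ LinearMap.ker (LinearMap.lsmul R M r) from this hx
  refine iSup_le fun L => iSup_le fun hL => iSup_le fun hLA => ?_
  rintro _ ⟨y, hy, rfl⟩
  have := Submodule.mem_annihilator.mp (h L (isFiniteLength_of_fg_of_isArtinian hL hLA)) y hy
  change r • L.subtype y = 0
  rw [← map_smul, this, map_zero]

end Preradical

/-! ### Comparing annihilators through maps to `E`. -/

section Annihilators

variable {R : Type u} [CommRing R] [IsLocalRing R]
  {E : Type u} [AddCommGroup E] [Module R E] {ι : ResidueField R →ₗ[R] E}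

theorem IsInjectiveHull.mem_annihilator_of_forall_hom (hE : IsInjectiveHull R E ι)
    {M : Type u} [AddCommGroup M] [Module R M] {N : Submodule R M} {r : R}
    (h : ∀ x ∈ N, ∀ f : M →ₗ[R] E, r • f x = 0) : r ∈ N.annihilator := by
  rw [Submodule.mem_annihilator]
  intro x hx
  by_contra h0
  obtain ⟨f, hf⟩ := hE.exists_hom_apply_ne_zero h0
  exact hf (by rw [map_smul, h x hx f])

theorem IsInjectiveHull.annihilator_le_of_isPreradical (hE : IsInjectiveHull R E ι)
    (hEA : artinianModules R E) {α : Selection R} (hα : IsPreradical (artinianModules R) α)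
    {M : Type u} [AddCommGroup M] [Module R M] (hM : artinianModules R M) :
    (α E).annihilator ≤ (α M).annihilator := fun _ hr =>
  hE.mem_annihilator_of_forall_hom fun _ hx f =>
    Submodule.mem_annihilator.mp hr _ (hα.apply_mem hM hEA f hx)

theorem IsInjectiveHull.annihilator_finitistic_le_of_isPreradical (hE : IsInjectiveHull R E ι)
    (hEA : artinianModules R E) {α : Selection R} (hα : IsPreradical (artinianModules R) α)
    {M : Type u} [AddCommGroup M] [Module R M] (hM : IsFiniteLength R M) :
    (finitistic (artinianModules R) α E).annihilator ≤ (α M).annihilator := by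
  intro r hr
  refine hE.mem_annihilator_of_forall_hom fun x hx f => Submodule.mem_annihilator.mp hr _ ?_
  obtain ⟨_, hA⟩ := isFiniteLength_iff_isNoetherian_isArtinian.mp hM
  have : IsArtinian R E := hEA
  have hA' : artinianModules R (LinearMap.range f) :=
    inferInstanceAs (IsArtinian R (LinearMap.range f))
  exact mem_finitistic (L := LinearMap.range f) (Module.Finite.iff_fg.mp inferInstance) hA'
    (hα.apply_mem hA hA' f.rangeRestrict hx)

variable [IsNoetherianRing R] [IsAdicComplete (maximalIdeal R) R]

/-- An irreducible `𝔪`-primary ideal `I` is the annihilator of an element that generates the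
submodule of `E` annihilated by `I`. -/
theorem IsInjectiveHull.exists_injective_hom_of_infIrred (hE : IsInjectiveHull R E ι)
    {I : Ideal R} (hI : IsMPrimary I) (hirr : InfIrred I) :
    ∃ g : (R ⧸ I) →ₗ[R] E, Function.Injective g ∧
      LinearMap.range g = torsionBySet R E (I : Set R) := by
  obtain ⟨n, hn⟩ := hI.exists_maximalIdeal_pow_le
  have hne : I ≠ ⊤ := fun h => hirr.1 (h ▸ isMax_top)
  -- A socle element of `R ⧸ I`, taken from the last power of `𝔪` not contained in `I`.
  obtain ⟨s, hs, hsm⟩ : ∃ s ∉ I, ∀ r ∈ maximalIdeal R, r * s ∈ I := by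
    classical
    have hex : ∃ n, maximalIdeal R ^ n ≤ I := ⟨n, hn⟩
    obtain ⟨k, hk⟩ : ∃ k, Nat.find hex = k + 1 := Nat.exists_eq_succ_of_ne_zero fun h0 => hne <| by
      have := Nat.find_spec hex
      rwa [h0, pow_zero, Ideal.one_eq_top, top_le_iff] at this
    obtain ⟨s, hs, hsI⟩ := Set.not_subset.mp (Nat.find_min hex (m := k) (by omega))
    refine ⟨s, hsI, fun r hr => Nat.find_spec hex ?_⟩
    rw [hk, pow_succ']
    exact Ideal.mul_mem_mul hr hs
  obtain ⟨g, hg⟩ := hE.exists_hom_apply_eq (Ideal.Quotient.mk I s) (ι 1) fun r hr => by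
    rw [hE.smul_map_one_eq_zero_iff, mem_maximalIdeal]
    intro hu
    rw [hu.smul_eq_zero, Ideal.Quotient.eq_zero_iff_mem] at hr
    exact hs hr
  have key : ∀ a : R, g (Ideal.Quotient.mk I a) = a • g 1 := fun a => by
    rw [← map_smul, Algebra.smul_def, mul_one, Ideal.Quotient.algebraMap_eq]
  have hann : ∀ a : R, a • g 1 = 0 → a ∈ I := by
    let J : Ideal R := LinearMap.ker (LinearMap.toSpanSingleton R E (g 1))
    have hIJ : I ≤ J := fun a ha => by
      change a • g 1 = 0
      rw [← key, Ideal.Quotient.eq_zero_iff_mem.mpr ha, map_zero]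
    -- Since `g` does not kill the class of `s`, the kernel `J` meets `I + (s)` only in `I`.
    -- Irreducibility then forces `J = I`, as `s ∉ I`.
    have hinf : J ⊓ (I ⊔ Ideal.span {s}) = I := by
      refine le_antisymm ?_ (le_inf hIJ le_sup_left)
      rintro a ⟨haJ, ha⟩
      obtain ⟨i, hi, z, hz, rfl⟩ := Submodule.mem_sup.mp ha
      obtain ⟨c, rfl⟩ := Ideal.mem_span_singleton'.mp hz
      have h1 : (c * s) • g 1 = 0 := by
        have := (J.add_mem_iff_right (hIJ hi)).mp haJ
        exact this
      rw [mul_smul, ← key, hg, hE.smul_map_one_eq_zero_iff] at h1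
      exact I.add_mem hi (hsm c h1)
    rcases hirr.2 hinf with h | h
    · exact fun a ha => h.le ha
    · exact absurd (h.le (Ideal.mem_sup_right (Ideal.mem_span_singleton_self s))) hs
  refine ⟨g, ?_, ?_⟩
  · rw [← LinearMap.ker_eq_bot, LinearMap.ker_eq_bot']
    intro x hx
    obtain ⟨a, rfl⟩ := Ideal.Quotient.mk_surjective x
    rw [key] at hx
    exact Ideal.Quotient.eq_zero_iff_mem.mpr (hann a hx)
  · refine le_antisymm ?_ fun e he => hE.mem_of_annihilator_smul_eq_zero fun r hr => ?_
    · rintro _ ⟨x, rfl⟩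
      rw [mem_torsionBySet_iff]
      rintro ⟨a, ha⟩
      rw [← map_smul, Algebra.smul_def, Ideal.Quotient.algebraMap_eq,
        Ideal.Quotient.eq_zero_iff_mem.mpr ha, zero_mul, map_zero]
    · exact (mem_torsionBySet_iff _ _).mp he
        ⟨r, hann r (Submodule.mem_annihilator.mp hr _ ⟨1, rfl⟩)⟩

theorem IsInjectiveHull.mem_annihilator_of_isApproximatelyGorenstein (hE : IsInjectiveHull R E ι)
    (hR : IsApproximatelyGorenstein R) {α : Selection R}
    (hα : IsPreradical (artinianModules R) α) {r : R}
    (hr : ∀ I : Ideal R, IsFiniteLength R (R ⧸ I) → r ∈ (α (R ⧸ I)).annihilator)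
    {M : Type u} [AddCommGroup M] [Module R M] (hM : IsFiniteLength R M) :
    r ∈ (α M).annihilator := by
  refine hE.mem_annihilator_of_forall_hom fun x hx f => ?_
  obtain ⟨_, hA⟩ := isFiniteLength_iff_isNoetherian_isArtinian.mp hM
  obtain ⟨n, hn⟩ : ∃ n, ∀ a ∈ maximalIdeal R ^ n, ∀ y, a • f y = 0 := by
    obtain ⟨S, hS⟩ := Module.Finite.fg_top (R := R) (M := M)
    choose N hN using hE.exists_maximalIdeal_pow_smul_eq_zero
    refine ⟨S.sup fun y => N (f y), fun a ha y => ?_⟩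
    have hle : (⊤ : Submodule R M) ≤ LinearMap.ker (a • f) := by
      rw [← hS, span_le]
      intro z hz
      exact hN (f z) a (Ideal.pow_le_pow_right (Finset.le_sup (f := fun y => N (f y)) hz) ha)
    exact hle (x := y) trivial
  obtain ⟨I, hIn, hIp, hirr⟩ := hR n
  obtain ⟨g, hg, hrange⟩ := hE.exists_injective_hom_of_infIrred hIp hirr
  have hfr : ∀ y, f y ∈ LinearMap.range g := fun y => by
    rw [hrange, mem_torsionBySet_iff]
    exact fun a => hn a (hIn a.2) y
  let h : M →ₗ[R] R ⧸ I :=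
    (LinearEquiv.ofInjective g hg).symm.toLinearMap ∘ₗ f.codRestrict _ hfr
  have hh : g (h x) = f x := by
    have := (LinearEquiv.ofInjective g hg).apply_symm_apply (f.codRestrict _ hfr x)
    exact congrArg Subtype.val this
  have hx' : h x ∈ α (R ⧸ I) :=
    hα.apply_mem hA (artinianModules_of_isFiniteLength hIp.isFiniteLength) h hx
  rw [← hh, ← map_smul, Submodule.mem_annihilator.mp (hr I hIp.isFiniteLength) _ hx', map_zero]

end Annihilators

/-! ### Residual closures and colon ideals. -/

section Closure

variable {R : Type u} [CommRing R]

/-- Residuality along `R → R ⧸ I` makes `I^cl` the preimage of `0^cl = α(R ⧸ I)`. -/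
theorem annihilator_eq_colon_of_represents {α : Selection R} {cl : PairOperation R}
    (hcl : IsResidualClosure (artinianModulesAndRing R) cl)
    (hα : Represents (artinianModules R) α cl) {I : Ideal R} (hI : IsFiniteLength R (R ⧸ I)) :
    (α (R ⧸ I)).annihilator = I.colon (cl R I : Set R) := by
  have hA := artinianModules_of_isFiniteLength hI
  have hres := hcl.residual R (R ⧸ I) (.inr ⟨LinearEquiv.refl R R⟩) (.inl hA) I.mkQ I.mkQ_surjective
  rw [Submodule.ker_mkQ] at hres
  rw [hα _ hA, hres]
  ext r
  rw [Submodule.mem_annihilator, Submodule.mem_colon]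
  have key : ∀ s : R, r • s ∈ I ↔ r • I.mkQ s = 0 := fun s => by
    rw [← map_smul, Submodule.mkQ_apply, Submodule.Quotient.mk_eq_zero]
  constructor
  · exact fun h s hs => (key s).mpr (h _ hs)
  · intro h y hy
    obtain ⟨s, rfl⟩ := I.mkQ_surjective y
    exact (key s).mp (h s hy)

theorem iInf_annihilator_eq_iInf_colon [IsLocalRing R] [IsNoetherianRing R]
    {α : Selection R} {cl : PairOperation R}
    (hcl : IsResidualClosure (artinianModulesAndRing R) cl)
    (hα : Represents (artinianModules R) α cl) (hap : HasMPrimaryApproximation R cl) :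
    (⨅ (I : Ideal R) (_ : IsFiniteLength R (R ⧸ I)), (α (R ⧸ I)).annihilator) =
      ⨅ I : Ideal R, I.colon (cl R I : Set R) := by
  refine le_antisymm (le_iInf fun J => ?_) (le_iInf fun I => le_iInf fun hI => ?_)
  · obtain ⟨S, hS, hJ, hclJ⟩ := hap J
    intro r hr
    simp only [Submodule.mem_iInf] at hr
    rw [Submodule.mem_colon]
    intro s hs
    rw [hJ]
    rw [SetLike.mem_coe, hclJ] at hs
    simp only [Submodule.mem_iInf] at hs ⊢
    intro I hI
    have := hr I (hS I hI).isFiniteLength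
    rw [annihilator_eq_colon_of_represents hcl hα (hS I hI).isFiniteLength,
      Submodule.mem_colon] at this
    exact this s (hs I hI)
  · rw [annihilator_eq_colon_of_represents hcl hα hI]
    exact iInf_le _ I

end Closure


/-! ### Krull intersection, prime avoidance and regular sequences. -/

section CommutativeAlgebra

variable {R : Type u} [CommRing R]

theorem mk_mem_span_singleton_iff {P : Ideal R} {a r : R} :
    Ideal.Quotient.mk P r ∈ Ideal.span {Ideal.Quotient.mk P a} ↔ r ∈ P ⊔ Ideal.span {a} := by
  rw [sup_comm, ← Ideal.mem_quotient_iff_mem_sup, Ideal.map_span, Set.image_singleton]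

/-- Krull's intersection theorem in the domain `R_x`: there `y` is not a unit, and `r` lies in every
power of `(y)`. -/
theorem eq_zero_of_forall_exists_mul_pow_mem [IsNoetherianRing R] [IsDomain R] {x y : R}
    (hx : x ≠ 0) (hxy : ∀ k, x ^ k ∉ Ideal.span {y}) {r : R}
    (hr : ∀ N, ∃ M, r * x ^ M ∈ Ideal.span {y ^ N}) : r = 0 := by
  let A := Localization.Away x
  have hle : Submonoid.powers x ≤ nonZeroDivisors R := powers_le_nonZeroDivisors_of_noZeroDivisors hx
  have : IsDomain A := IsLocalization.isDomain_of_le_nonZeroDivisors A hle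
  have : IsNoetherianRing A := IsLocalization.isNoetherianRing (Submonoid.powers x) A inferInstance
  have hinj : Function.Injective (algebraMap R A) := IsLocalization.injective A hle
  let I := (Ideal.span {y}).map (algebraMap R A)
  have hI : I ≠ ⊤ := by
    rw [Ne, Ideal.eq_top_iff_one, IsLocalization.mem_map_algebraMap_iff (Submonoid.powers x)]
    rintro ⟨⟨⟨a, ha⟩, ⟨_, k, rfl⟩⟩, h⟩
    rw [one_mul] at h
    have h' : x ^ k = a := hinj h
    exact hxy k (h' ▸ ha)
  have hmem : algebraMap R A r ∈ ⨅ N, I ^ N := by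
    rw [Ideal.mem_iInf]
    intro N
    rw [← Ideal.map_pow, Ideal.span_singleton_pow,
      IsLocalization.mem_map_algebraMap_iff (Submonoid.powers x)]
    obtain ⟨M, hM⟩ := hr N
    exact ⟨⟨⟨_, hM⟩, ⟨x ^ M, M, rfl⟩⟩, (map_mul _ _ _).symm⟩
  rw [Ideal.iInf_pow_eq_bot_of_isDomain I hI, Ideal.mem_bot] at hmem
  exact (map_eq_zero_iff _ hinj).mp hmem

theorem mem_of_forall_exists_mul_pow_mem_sup [IsNoetherianRing R] {P : Ideal R} [P.IsPrime]
    {x y : R} (hx : x ∉ P) (hxy : x ∉ (P ⊔ Ideal.span {y}).radical) {r : R}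
    (hr : ∀ N, ∃ M, r * x ^ M ∈ P ⊔ Ideal.span {y ^ N}) : r ∈ P := by
  rw [← Ideal.Quotient.eq_zero_iff_mem]
  refine eq_zero_of_forall_exists_mul_pow_mem (x := Ideal.Quotient.mk P x)
    (y := Ideal.Quotient.mk P y) (by rwa [Ne, Ideal.Quotient.eq_zero_iff_mem]) (fun k hk => ?_)
    fun N => (hr N).imp fun M hM => ?_
  · rw [← map_pow, mk_mem_span_singleton_iff] at hk
    exact hxy ⟨k, hk⟩
  · rwa [← map_pow, ← map_pow, ← map_mul, mk_mem_span_singleton_iff]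

/-- In a Noetherian local domain of dimension at least two there are two elements neither of
which divides a power of the other. -/
theorem exists_notMem_radical_sup_span [IsLocalRing R] [IsNoetherianRing R] {P Q : Ideal R}
    [P.IsPrime] [Q.IsPrime] (hPQ : P < Q) (hQ : Q ≠ maximalIdeal R) :
    ∃ x y, x ∉ (P ⊔ Ideal.span {y}).radical ∧ y ∉ (P ⊔ Ideal.span {x}).radical := by
  obtain ⟨x, hxQ, hxP⟩ := SetLike.exists_of_lt hPQ
  have hleQ : P ⊔ Ideal.span {x} ≤ Q :=
    sup_le hPQ.le ((Ideal.span_singleton_le_iff_mem _).mpr hxQ)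
  -- Prime avoidance: otherwise `𝔪` lies in a minimal prime of `P + (x)`, and that prime is
  -- contained in `Q`.
  obtain ⟨y, hym, hy⟩ : ∃ y ∈ maximalIdeal R, ∀ p ∈ (P ⊔ Ideal.span {x}).minimalPrimes, y ∉ p := by
    by_contra! h
    obtain ⟨p, hp, hmp⟩ := (Ideal.subset_union_prime_finite
      (Ideal.finite_minimalPrimes_of_isNoetherianRing R (P ⊔ Ideal.span {x})) (f := id) ⊥ ⊥
      (fun p hp _ _ => hp.1.1) (I := maximalIdeal R)).mp fun z hz => by
        simpa using h z hz
    have h1 : p ≤ Q := hp.2 ⟨inferInstance, hleQ⟩ ((le_maximalIdeal Ideal.IsPrime.ne_top').trans hmp)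
    exact hQ (le_antisymm (le_maximalIdeal Ideal.IsPrime.ne_top') (hmp.trans h1))
  refine ⟨x, y, fun hx => ?_, fun hy' => ?_⟩
  -- If `x` were in this radical, a minimal prime `Q'` of `P + (y)` would contain some `p` minimal
  -- over `P + (x)`. The chain `P < p < Q'`, strict because `x ∉ P` and `y ∉ p`, contradicts Krull's
  -- height theorem in `R ⧸ P`.
  · have hPm : P ⊔ Ideal.span {y} ≤ maximalIdeal R :=
      sup_le (le_maximalIdeal Ideal.IsPrime.ne_top') ((Ideal.span_singleton_le_iff_mem _).mpr hym)
    obtain ⟨Q', hQ', -⟩ := Ideal.exists_minimalPrimes_le hPm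
    have := hQ'.1.1
    have hxQ' : x ∈ Q' := this.radical_le_iff.mpr hQ'.1.2 hx
    obtain ⟨p, hp, hpQ'⟩ := Ideal.exists_minimalPrimes_le (I := P ⊔ Ideal.span {x}) (J := Q')
      (sup_le (le_sup_left.trans hQ'.1.2) ((Ideal.span_singleton_le_iff_mem _).mpr hxQ'))
    have := hp.1.1
    have hyQ' : y ∈ Q' := hQ'.1.2 (Ideal.mem_sup_right (Ideal.mem_span_singleton_self y))
    have hxp : x ∈ p := hp.1.2 (Ideal.mem_sup_right (Ideal.mem_span_singleton_self x))
    have hPp : P ≤ p := le_sup_left.trans hp.1.2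
    have hpr : ∀ q : Ideal R, q.IsPrime → P ≤ q → (q.map (Ideal.Quotient.mk P)).IsPrime :=
      fun q _ h => Ideal.map_isPrime_of_surjective Ideal.Quotient.mk_surjective
        (by rwa [Ideal.mk_ker])
    have hmem : ∀ q : Ideal R, P ≤ q → ∀ z, Ideal.Quotient.mk P z ∈ q.map (Ideal.Quotient.mk P) →
        z ∈ q := fun q h z hz => by
      rwa [Ideal.mem_quotient_iff_mem_sup, sup_eq_left.mpr h] at hz
    have := hpr p inferInstance hPp
    have := hpr Q' inferInstance (hPp.trans hpQ')
    have hht := Ideal.map_height_le_one_of_mem_minimalPrimes hQ'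
    have h1 := (Ideal.height_le_iff (n := 1)).mp (by exact_mod_cast hht)
      (p.map (Ideal.Quotient.mk P)) inferInstance <| by
        refine lt_of_le_not_ge (Ideal.map_mono hpQ') fun hle => hy p hp ?_
        exact hmem p hPp y (hle (Ideal.mem_map_of_mem _ hyQ'))
    have h2 := (Ideal.height_le_iff (n := 0)).mp
      (by rw [Nat.cast_zero]; exact (Order.lt_one_iff.mp (by exact_mod_cast h1)).le)
      ⊥ inferInstance <| bot_lt_iff_ne_bot.mpr fun hbot => hxP <| by
        rw [← Ideal.Quotient.eq_zero_iff_mem, ← Ideal.mem_bot, ← hbot]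
        exact Ideal.mem_map_of_mem _ hxp
    exact absurd h2 (by simp)
  · obtain ⟨p, hp, -⟩ := Ideal.exists_minimalPrimes_le hleQ
    have := hp.1.1
    exact hy p hp (this.radical_le_iff.mpr hp.1.2 hy')

theorem exists_notMem_forall_mem_of_ne {T : Finset (Ideal R)} (hT : ∀ P ∈ T, P.IsPrime)
    (hinc : ∀ P ∈ T, ∀ Q ∈ T, Q ≤ P → Q = P) {P : Ideal R} (hP : P ∈ T) :
    ∃ s ∉ P, ∀ Q ∈ T, Q ≠ P → s ∈ Q := by
  classical
  have := hT P hP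
  have : ∀ Q : Ideal R, ∃ t, Q ∈ T → Q ≠ P → t ∈ Q ∧ t ∉ P := fun Q => by
    by_cases h : Q ∈ T ∧ Q ≠ P
    · obtain ⟨t, ht⟩ := Set.not_subset.mp fun hle => h.2 (hinc P hP Q h.1 hle)
      exact ⟨t, fun _ _ => ht⟩
    · exact ⟨0, fun h1 h2 => absurd ⟨h1, h2⟩ h⟩
  choose t ht using this
  refine ⟨∏ Q ∈ T.erase P, t Q, ?_, fun Q hQ hne => ?_⟩
  · rw [Ideal.IsPrime.prod_mem_iff]
    rintro ⟨Q, hQ, h⟩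
    rw [Finset.mem_erase] at hQ
    exact (ht Q hQ.2 hQ.1).2 h
  · exact Q.mem_of_dvd (Finset.dvd_prod_of_mem t (Finset.mem_erase.mpr ⟨hne, hQ⟩)) (ht Q hQ hne).1

/-- Regularity of `x` modulo `y` passes to `y ^ N` by stripping off one factor `y` at a time, and
then to powers of `x`. -/
theorem mem_span_pow_of_mul_pow_mem {x y : R} (hy : IsSMulRegular R y)
    (hxy : IsSMulRegular (QuotSMulTop y R) x) (N M : ℕ) {r : R}
    (h : r * x ^ M ∈ Ideal.span {y ^ N}) : r ∈ Ideal.span {y ^ N} := by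
  have h1 : ∀ r : R, y ∣ r * x → y ∣ r := by
    intro r hr
    obtain ⟨c, hc⟩ := hr
    obtain ⟨d, -, hd⟩ := (isSMulRegular_quotient_iff_mem_of_smul_mem _ x).mp hxy r
      ⟨c, trivial, by simp [← hc, mul_comm]⟩
    exact ⟨d, hd.symm⟩
  have h2 : ∀ (N : ℕ) (r : R), y ^ N ∣ r * x → y ^ N ∣ r := by
    intro N
    induction N with
    | zero => simp
    | succ N ih =>
      rintro r ⟨c, hc⟩
      obtain ⟨d, rfl⟩ := h1 r ⟨y ^ N * c, by rw [hc]; ring⟩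
      rw [pow_succ']
      refine mul_dvd_mul_left y (ih d ⟨c, hy ?_⟩)
      simp only [smul_eq_mul]
      rw [← mul_assoc, hc]
      ring
  rw [Ideal.mem_span_singleton] at h ⊢
  induction M with
  | zero => simpa using h
  | succ M ih => exact ih (h2 N _ (by rwa [mul_assoc, ← pow_succ]))

end CommutativeAlgebra

/-! ### Locally cyclic hulls and the approximately Gorenstein examples. -/

section LocallyCyclic

variable {R : Type u} [CommRing R] {E : Type u} [AddCommGroup E] [Module R E]

/-- Any two elements of the submodule lie in one of its cyclic submodules. -/
def IsLocallyCyclic (N : Submodule R E) : Prop :=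
  ∀ x ∈ N, ∀ y ∈ N, ∃ z ∈ N, (∃ a : R, a • z = x) ∧ ∃ b : R, b • z = y

theorem IsLocallyCyclic.exists_le_span_singleton {N : Submodule R E} (hN : IsLocallyCyclic N)
    {L : Submodule R E} (hL : L.FG) (hLN : L ≤ N) : ∃ z ∈ N, L ≤ R ∙ z := by
  classical
  obtain ⟨S, rfl⟩ := hL
  rw [span_le] at hLN
  simp only [span_le]
  induction S using Finset.induction_on with
  | empty => exact ⟨0, N.zero_mem, by simp⟩
  | insert a S _ ih =>
    rw [Finset.coe_insert, Set.insert_subset_iff] at hLN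
    obtain ⟨z, hz, hS⟩ := ih hLN.2
    obtain ⟨w, hw, ⟨c, hc⟩, ⟨d, hd⟩⟩ := hN a hLN.1 z hz
    refine ⟨w, hw, ?_⟩
    rw [Finset.coe_insert, Set.insert_subset_iff]
    refine ⟨mem_span_singleton.mpr ⟨c, hc⟩, hS.trans ?_⟩
    rw [SetLike.coe_subset_coe, span_singleton_le_iff_mem]
    exact mem_span_singleton.mpr ⟨d, hd⟩

theorem mem_torsionBySet_ideal_iff {I : Ideal R} {e : E} :
    e ∈ torsionBySet R E (I : Set R) ↔ ∀ a ∈ I, a • e = 0 := by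
  rw [mem_torsionBySet_iff]
  exact ⟨fun h a ha => h ⟨a, ha⟩, fun h a => h a a.2⟩

namespace IsInjectiveHull

variable [IsLocalRing R] {ι : ResidueField R →ₗ[R] E}

/-- Any ideal strictly above `ann e` contains some `r` with `r • e = ι 1`. Two such elements differ
by an element of `ann e`, so two such ideals share one and cannot intersect in `ann e`. -/
theorem infIrred_annihilator (hE : IsInjectiveHull R E ι) {e : E} (he : e ≠ 0) :
    InfIrred (R ∙ e).annihilator := by
  have hmem : ∀ r : R, r ∈ (R ∙ e).annihilator ↔ r • e = 0 := fun r =>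
    mem_annihilator_span_singleton e r
  refine ⟨fun h => he ?_, fun b c hbc => ?_⟩
  · have h1 := (hmem 1).mp (h.eq_top ▸ trivial)
    rwa [one_smul] at h1
  · by_contra! hne
    have key : ∀ d : Ideal R, (R ∙ e).annihilator ≤ d → d ≠ (R ∙ e).annihilator →
        ∃ r ∈ d, r • e = ι 1 := by
      intro d hd hne
      obtain ⟨r, hr, hr0⟩ := Set.not_subset.mp fun hle => hne (le_antisymm hle hd)
      exact hE.map_one_mem (N := Submodule.map (LinearMap.toSpanSingleton R E e) d) <|
        (Submodule.ne_bot_iff _).mpr ⟨r • e, ⟨r, hr, rfl⟩, fun h => hr0 ((hmem r).mpr h)⟩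
    obtain ⟨r, hr, hre⟩ := key b (hbc ▸ inf_le_left) hne.1
    obtain ⟨s, hs, hse⟩ := key c (hbc ▸ inf_le_right) hne.2
    have hsub : r - s ∈ c := (hbc ▸ inf_le_right : (R ∙ e).annihilator ≤ c)
      ((hmem _).mpr (by rw [sub_smul, hre, hse, sub_self]))
    have hrc : r ∈ b ⊓ c := ⟨hr, by simpa using c.add_mem hsub hs⟩
    rw [hbc, hmem, hre] at hrc
    exact hE.map_one_ne_zero hrc

theorem isApproximatelyGorenstein [IsNoetherianRing R] (hE : IsInjectiveHull R E ι)
    (h : IsLocallyCyclic (⊤ : Submodule R E)) : IsApproximatelyGorenstein R := by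
  intro n
  -- The exponent `n + 1` keeps `ι 1` in the layer even for `n = 0`, so that `e ≠ 0`.
  let Z := torsionBySet R E ((maximalIdeal R ^ (n + 1) : Ideal R) : Set R)
  have hfin : Module.Finite R Z := by
    have := (isFiniteLength_iff_isNoetherian_isArtinian.mp (hE.isFiniteLength_torsionBySet
      (isFiniteLength_quotient_of_maximalIdeal_pow_le (le_refl (maximalIdeal R ^ (n + 1)))))).1
    infer_instance
  obtain ⟨e, -, he⟩ := h.exists_le_span_singleton (Module.Finite.iff_fg.mp hfin) le_top
  have he0 : e ≠ 0 := by
    rintro rfl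
    have h1 : ι 1 ∈ Z := mem_torsionBySet_ideal_iff.mpr fun a ha =>
      hE.smul_map_one_eq_zero_iff.mpr (Ideal.pow_le_self (Nat.succ_ne_zero n) ha)
    exact hE.map_one_ne_zero (by simpa using he h1)
  have hirr := hE.infIrred_annihilator he0
  obtain ⟨k, hk⟩ := hE.exists_maximalIdeal_pow_smul_eq_zero e
  refine ⟨(R ∙ e).annihilator, ?_, ?_, hirr⟩
  · calc (R ∙ e).annihilator ≤ Z.annihilator := annihilator_mono he
      _ = maximalIdeal R ^ (n + 1) := hE.annihilator_torsionBySet _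
      _ ≤ maximalIdeal R ^ n := Ideal.pow_le_pow_right n.le_succ
  · exact isMPrimary_of_maximalIdeal_pow_le
      (fun r hr => (mem_annihilator_span_singleton e r).mpr (hk r hr))
      fun htop => hirr.1 (htop ▸ isMax_top)

/-- Divide `e₁` by `a` inside `0 :_E (J + (b))` and `e₂` by `b` inside `0 :_E (J + (a))`; the sum of
the quotients has no cross terms. -/
theorem exists_smul_eq_and_smul_eq (hE : IsInjectiveHull R E ι) {J : Ideal R} {a b : R}
    {e₁ e₂ : E} (h₁ : ∀ r, r * a ∈ J ⊔ Ideal.span {b} → r • e₁ = 0)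
    (h₂ : ∀ r, r * b ∈ J ⊔ Ideal.span {a} → r • e₂ = 0) :
    ∃ z ∈ torsionBySet R E (J : Set R), a • z = e₁ ∧ b • z = e₂ := by
  obtain ⟨z₁, hz₁, rfl⟩ := hE.exists_smul_eq _ a e₁ h₁
  obtain ⟨z₂, hz₂, rfl⟩ := hE.exists_smul_eq _ b e₂ h₂
  refine ⟨z₁ + z₂, mem_torsionBySet_ideal_iff.mpr fun r hr => ?_, ?_, ?_⟩
  · rw [smul_add, hz₁ r (Ideal.mem_sup_left hr), hz₂ r (Ideal.mem_sup_left hr), add_zero]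
  · rw [smul_add, hz₂ a (Ideal.mem_sup_right (Ideal.mem_span_singleton_self a)), add_zero]
  · rw [smul_add, hz₁ b (Ideal.mem_sup_right (Ideal.mem_span_singleton_self b)), zero_add]

theorem exists_smul_eq_of_notMem (hE : IsInjectiveHull R E ι) {P : Ideal R} [P.IsPrime] {x : R}
    (hx : x ∉ P) {e : E} (he : e ∈ torsionBySet R E (P : Set R)) :
    ∃ e' ∈ torsionBySet R E (P : Set R), x • e' = e := by
  obtain ⟨e', h, h'⟩ := hE.exists_smul_eq P x e fun r hr =>
    mem_torsionBySet_ideal_iff.mp he r ((Ideal.IsPrime.mem_or_mem inferInstance hr).resolve_right hx)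
  exact ⟨e', mem_torsionBySet_ideal_iff.mpr h, h'⟩

variable [IsNoetherianRing R]

theorem isLocallyCyclic_of_depthAtLeastTwo (hE : IsInjectiveHull R E ι) (h : DepthAtLeastTwo R) :
    IsLocallyCyclic (⊤ : Submodule R E) := by
  obtain ⟨x, hx, y, hy, hreg⟩ := h
  have hreg' := isRegular_of_perm hreg (List.Perm.swap y x [])
  have h1 := hreg.toIsWeaklyRegular
  have h2 := hreg'.toIsWeaklyRegular
  rw [RingTheory.Sequence.isWeaklyRegular_cons_iff,
    RingTheory.Sequence.isWeaklyRegular_singleton_iff] at h1 h2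
  intro e₁ _ e₂ _
  obtain ⟨n₁, hn₁⟩ := hE.exists_maximalIdeal_pow_smul_eq_zero e₁
  obtain ⟨n₂, hn₂⟩ := hE.exists_maximalIdeal_pow_smul_eq_zero e₂
  let n := max n₁ n₂
  have hy₁ : Ideal.span {y ^ n} ≤ maximalIdeal R ^ n₁ := (Ideal.span_singleton_le_iff_mem _).mpr
    (Ideal.pow_le_pow_right (le_max_left _ _) (Ideal.pow_mem_pow hy n))
  have hx₂ : Ideal.span {x ^ n} ≤ maximalIdeal R ^ n₂ := (Ideal.span_singleton_le_iff_mem _).mpr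
    (Ideal.pow_le_pow_right (le_max_right _ _) (Ideal.pow_mem_pow hx n))
  obtain ⟨z, -, hz₁, hz₂⟩ := hE.exists_smul_eq_and_smul_eq (J := ⊥) (a := x ^ n) (b := y ^ n)
    (e₁ := e₁) (e₂ := e₂)
    (fun r hr => hn₁ r (hy₁ (mem_span_pow_of_mul_pow_mem h2.1 h2.2 n n (by rwa [bot_sup_eq] at hr))))
    (fun r hr => hn₂ r (hx₂ (mem_span_pow_of_mul_pow_mem h1.1 h1.2 n n (by rwa [bot_sup_eq] at hr))))
  exact ⟨z, trivial, ⟨_, hz₁⟩, ⟨_, hz₂⟩⟩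

variable [IsAdicComplete (maximalIdeal R) R]

/-- If a descending sequence of ideals has intersection inside `P`, then the elements of `E`
annihilated by `P` are annihilated by some term of the sequence. -/
theorem exists_mem_torsionBySet_of_antitone (hE : IsInjectiveHull R E ι) {b : ℕ → Ideal R}
    (hb : Antitone b) {P : Ideal R} (hP : ∀ r, (∀ n, r ∈ b n) → r ∈ P) {e : E}
    (he : e ∈ torsionBySet R E (P : Set R)) : ∃ n, ∀ m, n ≤ m → ∀ r ∈ b m, r • e = 0 := by
  have hmono : Monotone fun n => torsionBySet R E (b n : Set R) := fun i j hij =>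
    torsionBySet_le_torsionBySet_of_subset (hb hij)
  have hmem : e ∈ ⨆ n, torsionBySet R E (b n : Set R) := by
    refine hE.mem_of_annihilator_smul_eq_zero fun r hr =>
      mem_torsionBySet_ideal_iff.mp he r (hP r fun n => ?_)
    rw [← hE.annihilator_torsionBySet (b n)]
    exact annihilator_mono (le_iSup (fun n => torsionBySet R E (b n : Set R)) n) hr
  obtain ⟨n, hn⟩ := (mem_iSup_of_directed _ hmono.directed_le).mp hmem
  exact ⟨n, fun m hm r hr => mem_torsionBySet_ideal_iff.mp (hmono hm hn) r hr⟩

/-- The saturations of `P + (y ^ N)` by powers of `x` decrease with `N` and intersect inside `P`.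
The bound `n` is uniform in `M`, so `M = N` can be chosen later. -/
theorem exists_forall_smul_eq_zero_of_notMem_radical (hE : IsInjectiveHull R E ι) {P : Ideal R}
    [P.IsPrime] {x y : R} (hxy : x ∉ (P ⊔ Ideal.span {y}).radical) {e : E}
    (he : e ∈ torsionBySet R E (P : Set R)) :
    ∃ n, ∀ N, n ≤ N → ∀ M r, r * x ^ M ∈ P ⊔ Ideal.span {y ^ N} → r • e = 0 := by
  let b : ℕ → Ideal R := fun N =>
    { carrier := {r | ∃ M, r * x ^ M ∈ P ⊔ Ideal.span {y ^ N}}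
      add_mem' := by
        rintro r s ⟨M, hM⟩ ⟨M', hM'⟩
        refine ⟨M + M', ?_⟩
        have : (r + s) * x ^ (M + M') = x ^ M' * (r * x ^ M) + x ^ M * (s * x ^ M') := by ring
        rw [this]
        exact add_mem (Ideal.mul_mem_left _ _ hM) (Ideal.mul_mem_left _ _ hM')
      zero_mem' := ⟨0, by rw [zero_mul]; exact zero_mem _⟩
      smul_mem' := by
        rintro c r ⟨M, hM⟩
        exact ⟨M, by rw [smul_eq_mul, mul_assoc]; exact Ideal.mul_mem_left _ _ hM⟩ }
  have hb : Antitone b := by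
    rintro i j hij r ⟨M, hM⟩
    refine ⟨M, sup_le_sup_left ?_ P hM⟩
    rw [Ideal.span_singleton_le_span_singleton]
    exact pow_dvd_pow y hij
  have hx : x ∉ P := fun h => hxy (Ideal.le_radical (Ideal.mem_sup_left h))
  obtain ⟨n, hn⟩ := hE.exists_mem_torsionBySet_of_antitone hb
    (fun r hr => mem_of_forall_exists_mul_pow_mem_sup hx hxy hr) he
  exact ⟨n, fun N hN M r hr => hn N hN r ⟨M, hr⟩⟩

/-- For every prime `P`, the injective hull over `R ⧸ P` is locally cyclic. -/
theorem isLocallyCyclic_torsionBySet (hE : IsInjectiveHull R E ι) (P : Ideal R) [P.IsPrime] :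
    IsLocallyCyclic (torsionBySet R E (P : Set R)) := by
  have hPm : P ≤ maximalIdeal R := le_maximalIdeal Ideal.IsPrime.ne_top'
  have hι : ι 1 ∈ torsionBySet R E (P : Set R) := mem_torsionBySet_ideal_iff.mpr fun a ha =>
    hE.smul_map_one_eq_zero_iff.mpr (hPm ha)
  by_cases hP : P = maximalIdeal R
  · intro e₁ h₁ e₂ h₂
    rw [hP, mem_torsionBySet_ideal_iff] at h₁ h₂
    exact ⟨ι 1, hι, mem_range_iff.mp (hE.mem_range_of_maximalIdeal_smul h₁),
      mem_range_iff.mp (hE.mem_range_of_maximalIdeal_smul h₂)⟩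
  -- When `R ⧸ P` has dimension one, dividing `ι 1` repeatedly by `x` gives a chain of cyclic
  -- modules `R ∙ w n`. It exhausts `0 :_E P`: if `a ∉ P` killed every `w n`, some `x ^ k ∈ P + (a)`
  -- would kill `w k`, although `x ^ k • w k = ι 1`.
  by_cases hdim : ∀ Q : Ideal R, Q.IsPrime → P < Q → Q = maximalIdeal R
  · obtain ⟨x, hxm, hxP⟩ := SetLike.exists_of_lt (lt_of_le_of_ne hPm hP)
    have hpow : ∀ a ∉ P, x ∈ (P ⊔ Ideal.span {a}).radical := by
      intro a ha
      rw [Ideal.radical_eq_sInf, Submodule.mem_sInf]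
      rintro Q ⟨hle, hQ⟩
      have hlt : P < Q := lt_of_le_of_ne (le_sup_left.trans hle) fun h =>
        ha (h ▸ hle (Ideal.mem_sup_right (Ideal.mem_span_singleton_self a)))
      rwa [hdim Q hQ hlt]
    choose d hd using fun e : torsionBySet R E (P : Set R) => hE.exists_smul_eq_of_notMem hxP e.2
    let w : ℕ → torsionBySet R E (P : Set R) := fun n =>
      (fun e => ⟨d e, (hd e).1⟩)^[n] ⟨ι 1, hι⟩
    have hw : ∀ n, x • (w (n + 1) : E) = w n := fun n => by
      simp only [w, Function.iterate_succ_apply']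
      exact (hd (w n)).2
    have hwpow : ∀ n, x ^ n • (w n : E) = ι 1 := fun n => by
      induction n with
      | zero => rw [pow_zero, one_smul]; rfl
      | succ n ih => rw [pow_succ, mul_smul, hw, ih]
    have hmono : Monotone fun n => R ∙ (w n : E) := monotone_nat_of_le_succ fun n => by
      rw [span_singleton_le_iff_mem]
      exact mem_span_singleton.mpr ⟨x, hw n⟩
    have hall : ∀ e ∈ torsionBySet R E (P : Set R), ∃ n, e ∈ R ∙ (w n : E) := by
      intro e he
      rw [← mem_iSup_of_directed _ hmono.directed_le]
      refine hE.mem_of_annihilator_smul_eq_zero fun a ha => mem_torsionBySet_ideal_iff.mp he a ?_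
      by_contra haP
      obtain ⟨k, hk⟩ := hpow a haP
      obtain ⟨p, hp, q, hq, hpq⟩ := Submodule.mem_sup.mp hk
      obtain ⟨c, rfl⟩ := Ideal.mem_span_singleton'.mp hq
      have haw : a • (w k : E) = 0 := Submodule.mem_annihilator.mp ha _
        (le_iSup (fun n => R ∙ (w n : E)) k (mem_span_singleton_self _))
      refine hE.map_one_ne_zero ?_
      rw [← hwpow k, ← hpq, add_smul, mul_smul, haw, smul_zero, add_zero]
      exact mem_torsionBySet_ideal_iff.mp (w k).2 p hp
    intro e₁ h₁ e₂ h₂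
    obtain ⟨n₁, hn₁⟩ := hall e₁ h₁
    obtain ⟨n₂, hn₂⟩ := hall e₂ h₂
    exact ⟨w (max n₁ n₂), (w _).2, mem_span_singleton.mp (hmono (le_max_left n₁ n₂) hn₁),
      mem_span_singleton.mp (hmono (le_max_right n₁ n₂) hn₂)⟩
  · push Not at hdim
    obtain ⟨Q, hQ, hPQ, hQm⟩ := hdim
    obtain ⟨x, y, hxy, hyx⟩ := exists_notMem_radical_sup_span hPQ hQm
    intro e₁ h₁ e₂ h₂
    obtain ⟨n₁, hn₁⟩ := hE.exists_forall_smul_eq_zero_of_notMem_radical hxy h₁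
    obtain ⟨n₂, hn₂⟩ := hE.exists_forall_smul_eq_zero_of_notMem_radical hyx h₂
    obtain ⟨z, hz, hz₁, hz₂⟩ := hE.exists_smul_eq_and_smul_eq (J := P)
      (hn₁ (max n₁ n₂) (le_max_left _ _) (max n₁ n₂))
      (hn₂ (max n₁ n₂) (le_max_right _ _) (max n₁ n₂))
    exact ⟨z, hz, ⟨_, hz₁⟩, ⟨_, hz₂⟩⟩

theorem isLocallyCyclic_of_isReduced (hE : IsInjectiveHull R E ι) [IsReduced R] :
    IsLocallyCyclic (⊤ : Submodule R E) := by
  have hfin := Ideal.finite_minimalPrimes_of_isNoetherianRing R ⊥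
  let T := hfin.toFinset
  have hT : ∀ P ∈ T, P ∈ (⊥ : Ideal R).minimalPrimes := fun P hP => hfin.mem_toFinset.mp hP
  have hprime : ∀ P ∈ T, P.IsPrime := fun P hP => (hT P hP).1.1
  have hsum : ∀ e : E, ∃ μ : (P : Ideal R) → torsionBySet R E (P : Set R),
      ∑ P ∈ T, (μ P : E) = e := by
    intro e
    rw [← mem_iSup_finset_iff_exists_sum]
    -- An annihilator of the whole sum lies in every minimal prime, hence is nilpotent, hence zero.
    refine hE.mem_of_annihilator_smul_eq_zero fun r hr => ?_
    have hr0 : r ∈ (⊥ : Ideal R).radical := by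
      rw [← Ideal.sInf_minimalPrimes, Submodule.mem_sInf]
      intro P hP
      rw [← hE.annihilator_torsionBySet P]
      have hle : torsionBySet R E (P : Set R) ≤ ⨆ Q ∈ T, torsionBySet R E (Q : Set R) :=
        le_biSup (fun Q : Ideal R => torsionBySet R E (Q : Set R)) (hfin.mem_toFinset.mpr hP)
      exact annihilator_mono hle hr
    obtain ⟨k, hk⟩ := hr0
    have hr0 : r = 0 := eq_zero_of_pow_eq_zero hk
    rw [hr0, zero_smul]
  have hsep : ∀ P : Ideal R, ∃ s, P ∈ T → s ∉ P ∧ ∀ Q ∈ T, Q ≠ P → s ∈ Q := fun P => by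
    by_cases hP : P ∈ T
    · obtain ⟨s, hs⟩ := exists_notMem_forall_mem_of_ne hprime
        (fun P hP Q hQ hle => le_antisymm hle ((hT P hP).2 (hT Q hQ).1 hle)) hP
      exact ⟨s, fun _ => hs⟩
    · exact ⟨0, fun h => absurd h hP⟩
  choose s hs using hsep
  intro x _ y _
  obtain ⟨μ, rfl⟩ := hsum x
  obtain ⟨ν, rfl⟩ := hsum y
  -- The local generator is divided by `s P` beforehand, so that multiplying the sum of all `z Q` by
  -- `s P`, which kills the other summands, gives the generator back.
  have hz : ∀ P : Ideal R, ∃ z ∈ torsionBySet R E (P : Set R), P ∈ T →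
      (∃ a : R, a • s P • z = μ P) ∧ ∃ b : R, b • s P • z = ν P := fun P => by
    by_cases hP : P ∈ T
    · have := hprime P hP
      obtain ⟨c, hc, ha, hb⟩ := hE.isLocallyCyclic_torsionBySet P _ (μ P).2 _ (ν P).2
      obtain ⟨z, hz, rfl⟩ := hE.exists_smul_eq_of_notMem (hs P hP).1 hc
      exact ⟨z, hz, fun _ => ⟨ha, hb⟩⟩
    · exact ⟨0, zero_mem _, fun h => absurd h hP⟩
  choose z hz hz' using hz
  have key : ∀ P ∈ T, s P • ∑ Q ∈ T, z Q = s P • z P := fun P hP => by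
    rw [Finset.smul_sum]
    refine Finset.sum_eq_single P (fun Q hQ hne => ?_) fun h => absurd hP h
    exact mem_torsionBySet_ideal_iff.mp (hz Q) _ ((hs P hP).2 Q hQ hne)
  have hcomb : ∀ μ : (P : Ideal R) → torsionBySet R E (P : Set R),
      (∀ P ∈ T, ∃ a : R, a • s P • z P = μ P) →
        ∃ a : R, a • ∑ Q ∈ T, z Q = ∑ P ∈ T, (μ P : E) := by
    intro μ hμ
    have : ∀ P : Ideal R, ∃ a : R, P ∈ T → a • s P • z P = μ P := fun P => by
      by_cases hP : P ∈ T
      · exact (hμ P hP).imp fun _ h _ => h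
      · exact ⟨0, fun h => absurd h hP⟩
    choose a ha using this
    refine ⟨∑ P ∈ T, a P * s P, ?_⟩
    rw [Finset.sum_smul]
    exact Finset.sum_congr rfl fun P hP => by rw [mul_smul, key P hP, ha P hP]
  exact ⟨_, trivial, hcomb μ fun P hP => (hz' P hP).1, hcomb ν fun P hP => (hz' P hP).2⟩

end IsInjectiveHull

end LocallyCyclic

end TestIdeal

theorem theorem5p5 {R : Type u} [CommRing R] [IsLocalRing R] [IsNoetherianRing R]
    [IsAdicComplete (IsLocalRing.maximalIdeal R) R]
    (E : Type u) [AddCommGroup E] [Module R E] (ι : IsLocalRing.ResidueField R →ₗ[R] E)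
    (hE : TestIdeal.IsInjectiveHull R E ι)
    (α : TestIdeal.Selection R)
    (hα : TestIdeal.IsPreradical (TestIdeal.artinianModules R) α) :
    let αf : TestIdeal.Selection R := TestIdeal.finitistic (TestIdeal.artinianModules R) α
    -- `E` belongs to the category on which `α` is given
    TestIdeal.artinianModules R E ∧
    TestIdeal.smileDual E α R = (α E).annihilator ∧
    (α E).annihilator =
      (⨅ (M : Type u) (_ : AddCommGroup M) (_ : Module R M) (_ : TestIdeal.artinianModules R M),
        (α M).annihilator) ∧
    (⨅ (M : Type u) (_ : AddCommGroup M) (_ : Module R M) (_ : TestIdeal.artinianModules R M),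
        (α M).annihilator) ≤ TestIdeal.smileDual E αf R ∧
    TestIdeal.smileDual E αf R = (αf E).annihilator ∧
    (αf E).annihilator =
      (⨅ (M : Type u) (_ : AddCommGroup M) (_ : Module R M) (_ : IsFiniteLength R M),
        (α M).annihilator) ∧
    (⨅ (M : Type u) (_ : AddCommGroup M) (_ : Module R M) (_ : IsFiniteLength R M),
        (α M).annihilator) ≤
      (⨅ (I : Ideal R) (_ : IsFiniteLength R (R ⧸ I)), (α (R ⧸ I)).annihilator) ∧
    -- equality for approximately Gorenstein rings, e.g. reduced ones or those of depth at least 2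
    (TestIdeal.IsApproximatelyGorenstein R →
      (⨅ (M : Type u) (_ : AddCommGroup M) (_ : Module R M) (_ : IsFiniteLength R M),
        (α M).annihilator) =
      (⨅ (I : Ideal R) (_ : IsFiniteLength R (R ⧸ I)), (α (R ⧸ I)).annihilator)) ∧
    (IsReduced R → TestIdeal.IsApproximatelyGorenstein R) ∧
    (TestIdeal.DepthAtLeastTwo R → TestIdeal.IsApproximatelyGorenstein R) ∧
    -- closure operations on Artinian modules and on all ideals
    (∀ cl : TestIdeal.PairOperation R,
      TestIdeal.IsResidualClosure (TestIdeal.artinianModulesAndRing R) cl →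
      TestIdeal.Represents (TestIdeal.artinianModules R) α cl →
      TestIdeal.HasMPrimaryApproximation R cl →
      (⨅ (I : Ideal R) (_ : IsFiniteLength R (R ⧸ I)), (α (R ⧸ I)).annihilator) =
        ⨅ I : Ideal R, I.colon (cl R I : Set R)) := by
  intro αf
  have hA : IsArtinian R E := hE.isArtinian
  have hαE : (α E).annihilator =
      (⨅ (M : Type u) (_ : AddCommGroup M) (_ : Module R M) (_ : TestIdeal.artinianModules R M),
        (α M).annihilator) :=
    le_antisymm
      (le_iInf fun M => le_iInf fun _ => le_iInf fun _ => le_iInf fun hM =>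
        hE.annihilator_le_of_isPreradical hA hα hM)
      (iInf_le_of_le E <| iInf_le_of_le _ <| iInf_le_of_le _ <| iInf_le_of_le hA le_rfl)
  have hdual := hα.finitistic.toIsSubmoduleSelector.smileDual_eq (E := E)
  have hquot : (⨅ (M : Type u) (_ : AddCommGroup M) (_ : Module R M) (_ : IsFiniteLength R M),
      (α M).annihilator) ≤
      (⨅ (I : Ideal R) (_ : IsFiniteLength R (R ⧸ I)), (α (R ⧸ I)).annihilator) :=
    le_iInf fun I => le_iInf fun hI =>
      iInf_le_of_le (R ⧸ I) <| iInf_le_of_le _ <| iInf_le_of_le _ <| iInf_le_of_le hI le_rfl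
  refine ⟨hA, hα.toIsSubmoduleSelector.smileDual_eq, hαE, ?_, hdual, ?_, hquot, ?_, ?_, ?_,
    fun cl hcl hrep hap => TestIdeal.iInf_annihilator_eq_iInf_colon hcl hrep hap⟩
  · rw [← hαE]
    exact (Submodule.annihilator_mono (hα.finitistic_le hA)).trans hdual.ge
  · refine le_antisymm (le_iInf fun M => le_iInf fun _ => le_iInf fun _ => le_iInf fun hM =>
      hE.annihilator_finitistic_le_of_isPreradical hA hα hM) fun r hr => ?_
    simp only [Submodule.mem_iInf] at hr
    exact TestIdeal.mem_annihilator_finitistic fun L _ _ hL => hr L _ _ hL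
  · intro hR
    refine le_antisymm hquot fun r hr => ?_
    simp only [Submodule.mem_iInf] at hr ⊢
    exact fun M _ _ hM => hE.mem_annihilator_of_isApproximatelyGorenstein hR hα hr hM
  · intro _
    exact hE.isApproximatelyGorenstein hE.isLocallyCyclic_of_isReduced
  · intro h
    exact hE.isApproximatelyGorenstein (hE.isLocallyCyclic_of_depthAtLeastTwo h)
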